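/- Let $n \ge 1$. For real numbers $a_1,\dots,a_n$ let the whirl matrix $M(a_1,\dots,a_n)$ be the $n\times n$ matrix over $\mathbb{R}[t]$ which is the sum of the identity matrix, of the entries $a_i$ in positions $(i,i+1)$ for $1\le i\le n-1$, and of the entry $a_n t$ in position $(n,1)$ (so $M(a_1)=1+a_1t$ for $n=1$). Let $P(t)=\sum_{d\ge 0}A_d t^d$ be an $n\times n$ matrix with entries in $\mathbb{R}[t]$ (so $A_d = 0$ for all large $d$) and put $A_d=0$ for $d<0$. Let $X_P$ be the doubly infinite block-Toeplitz matrix whose block in block row $I\in\mathbb{Z}$ and block column $J\in\mathbb{Z}$ is $A_{J-I}$. We call $P(t)$ totally nonnegative if every minor of $X_P$ (the determinant of the submatrix on finitely many rows and equally many columns, each taken in increasing order) is nonnegative. Theorem. Suppose that $P(0)$ is uni-upper triangular, that is, upper triangular with $1$'s on the diagonal. Then $P(t)$ is totally nonnegative if and only if there are an integer $m\ge 0$ and real numbers $x_k^{(i)}\ge 0$ ($1\le k\le m$, $1\le i\le n$) such that $$P(t)=M(x_1^{(1)},\dots,x_1^{(n)})\,M(x_2^{(1)},\dots,x_2^{(n)})\cdots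 M(x_m^{(1)},\dots,x_m^{(n)}),$$ where the empty product ($m = 0$) is the identity matrix. -/

import Mathlib

open Polynomial

namespace LoopTP

/-- The `n × n` whirl matrix `M(a_1, …, a_n)`, with indices and parameters numbered from `0` to
`n - 1`: ones on the diagonal, `a_i` at position `(i, i + 1)` for `i + 1 < n`, and in addition
`a_{n - 1} t` at the corner position `(n - 1, 0)`. For `n = 1` this is `1 + a_0 t`. -/
noncomputable def whirl {n : ℕ} (a : Fin n → ℝ) : Matrix (Fin n) (Fin n) ℝ[X] :=
  1 + Matrix.of fun (i j : Fin n) =>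
    if (i : ℕ) + 1 = (j : ℕ) then C (a i)
    else if (i : ℕ) + 1 = n ∧ (j : ℕ) = 0 then C (a i) * X
    else 0

/-- A real matrix is uni-upper triangular: zero below the diagonal and one on the diagonal. -/
def IsUniUpperTriangular {n : ℕ} (A : Matrix (Fin n) (Fin n) ℝ) : Prop :=
  (∀ i j, j < i → A i j = 0) ∧ ∀ i, A i i = 1

/-- The value `P(c)` of a matrix polynomial at a real number `c`. -/
noncomputable def evalAt {n : ℕ} (P : Matrix (Fin n) (Fin n) ℝ[X]) (c : ℝ) :
    Matrix (Fin n) (Fin n) ℝ :=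
  P.map (eval c)

/-- The position of the integer index `i` inside its block of size `n`. -/
def residue (n : ℕ) [NeZero n] (i : ℤ) : Fin n :=
  ⟨(i % (n : ℤ)).toNat, by
    have hn : (0 : ℤ) < n := by exact_mod_cast Nat.pos_of_ne_zero (NeZero.ne n)
    have h1 := Int.emod_nonneg i hn.ne'
    have h2 := Int.emod_lt_of_pos i hn
    omega⟩

/-- The coefficient of `t ^ d` for an integer `d`, which is zero for negative `d`. -/
noncomputable def intCoeff (p : ℝ[X]) (d : ℤ) : ℝ :=
  if 0 ≤ d then p.coeff d.toNat else 0

/-- The infinite periodic matrix `X_P`, with rows and columns indexed by `ℤ`: it is the block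
Toeplitz matrix whose block in block row `I` and block column `J` is the coefficient of
`t ^ (J - I)` in `P(t)`; the integer index `i` lies in the block `⌊i / n⌋`. -/
noncomputable def blockToeplitz {n : ℕ} [NeZero n] (P : Matrix (Fin n) (Fin n) ℝ[X]) :
    Matrix ℤ ℤ ℝ :=
  Matrix.of fun i j => intCoeff (P (residue n i) (residue n j)) (j / (n : ℤ) - i / (n : ℤ))

/-- `P(t)` is totally nonnegative: every minor of `X_P` (finitely many rows and equally many
columns, both in increasing order) is nonnegative. -/
def IsTotallyNonneg {n : ℕ} [NeZero n] (P : Matrix (Fin n) (Fin n) ℝ[X]) : Prop :=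
  ∀ (k : ℕ) (r c : Fin k → ℤ), StrictMono r → StrictMono c →
    0 ≤ ((blockToeplitz P).submatrix r c).det

end LoopTP

namespace LoopTP

/-! Left multiplication by a whirl matrix acts on `X_P` by adding to each row a nonnegative multiple
of the next row. Expanding a minor of the result row by row gives a nonnegative combination of
minors of `X_P`, so products of whirls are totally nonnegative.

For the converse, `X_P` is unit upper triangular, `n`-periodic and of finite bandwidth. It suffices
to split off one whirl, `X = M Y`, with `Y` of the same kind and with fewer nonzero entries above
the diagonal per period; induction then ends at the identity. Let `r i` be the last column where row
`i` is nonzero. Total nonnegativity makes `r` weakly increasing, which leaves two cases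
(`exists_reduction`).

If `r k = r (k + 1)` for some `k`, take the least such `k` of its run and subtract from row `k` the
multiple of row `k + 1` that kills the entry in column `r k`, in all rows congruent to `k` modulo
`n` (`exists_reduction_of_eq`). This is Neville elimination, which preserves total nonnegativity
(`TotallyNonneg.neville`).

Otherwise `r` is strictly increasing, and periodicity forces `r i = i + w`. All rows must now be
reduced at once, and each elimination needs the already reduced next row, so there is no place to
start. The elimination is therefore started artificially at row `i + m`, with that row truncated,
and carried upwards to row `i`. The result decreases entrywise in `m` (`IsStrictBand.diff`) and is
nonnegative; its limit as `m → ∞` is the required `Y` (`exists_reduction_of_strictBand`). -/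

open Matrix Function Filter Topology

/-! ### Total nonnegativity and the operations that preserve it -/

/-- All minors of the matrix, on increasing rows and columns, are nonnegative. -/
def TotallyNonneg (A : Matrix ℤ ℤ ℝ) : Prop :=
  ∀ (q : ℕ) (r c : Fin q → ℤ), StrictMono r → StrictMono c → 0 ≤ (A.submatrix r c).det

theorem TotallyNonneg.entry_nonneg {A : Matrix ℤ ℤ ℝ} (hA : TotallyNonneg A) (i j : ℤ) :
    0 ≤ A i j := by
  have h := hA 1 (fun _ => i) (fun _ => j) (Subsingleton.strictMono _) (Subsingleton.strictMono _)
  simpa using h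

theorem TotallyNonneg.mul_le_mul {A : Matrix ℤ ℤ ℝ} (hA : TotallyNonneg A) {i i' j j' : ℤ}
    (hi : i < i') (hj : j < j') : A i j' * A i' j ≤ A i j * A i' j' := by
  have h := hA 2 ![i, i'] ![j, j']
    (by intro a b hab; fin_cases a <;> fin_cases b <;> simp_all)
    (by intro a b hab; fin_cases a <;> fin_cases b <;> simp_all)
  rw [det_fin_two] at h
  simpa using h

theorem TotallyNonneg.det_nonneg_of_monotone {A : Matrix ℤ ℤ ℝ} (hA : TotallyNonneg A) {q : ℕ}
    {r c : Fin q → ℤ} (hr : Monotone r) (hc : StrictMono c) : 0 ≤ (A.submatrix r c).det := by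
  by_cases h : Injective r
  · exact hA q r c (hr.strictMono_of_injective h) hc
  · simp only [Injective, not_forall] at h
    obtain ⟨a, b, hab, hne⟩ := h
    refine (det_zero_of_row_eq hne ?_).ge
    ext x
    simp [hab]

/-- Total nonnegativity is determined by the windows of rows `i, i + 1, …`. -/
theorem TotallyNonneg.of_window {A : Matrix ℤ ℤ ℝ}
    (h : ∀ lo hi : ℤ, ∃ B : Matrix ℤ ℤ ℝ, TotallyNonneg B ∧ ∀ i, lo ≤ i → i ≤ hi → B i = A i) :
    TotallyNonneg A := by
  intro q r c hr hc
  cases q with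
  | zero => simp
  | succ q =>
    obtain ⟨B, hB, hBA⟩ := h (r 0) (r (Fin.last q))
    have : A.submatrix r c = B.submatrix r c := by
      ext a b
      simp [hBA (r a) (hr.monotone (Fin.zero_le a)) (hr.monotone (Fin.le_last a))]
    rw [this]
    exact hB _ r c hr hc

theorem TotallyNonneg.of_tendsto {A : ℕ → Matrix ℤ ℤ ℝ} {B : Matrix ℤ ℤ ℝ}
    (hA : ∀ m, TotallyNonneg (A m)) (h : ∀ i j, Tendsto (fun m => A m i j) atTop (𝓝 (B i j))) :
    TotallyNonneg B := by
  intro q r c hr hc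
  have hsub : Tendsto (fun m => (A m).submatrix r c) atTop (𝓝 (B.submatrix r c)) := by
    refine tendsto_pi_nhds.2 fun a => tendsto_pi_nhds.2 fun b => ?_
    exact h _ _
  have hdet : Tendsto (fun m => ((A m).submatrix r c).det) atTop (𝓝 (B.submatrix r c).det) :=
    ((continuous_id.matrix_det).tendsto (B.submatrix r c)).comp hsub
  exact ge_of_tendsto' hdet fun m => hA m q r c hr hc

theorem submatrix_update (A : Matrix ℤ ℤ ℝ) {q : ℕ} (r c : Fin q → ℤ) (p : Fin q) (i : ℤ) :
    A.submatrix (update r p i) c = (A.submatrix r c).updateRow p (fun x => A i (c x)) := by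
  ext a b
  by_cases h : a = p
  · subst h; simp
  · simp [h]

theorem updateRow_submatrix_of_injective (A : Matrix ℤ ℤ ℝ) {q : ℕ} {r : Fin q → ℤ} (c : Fin q → ℤ)
    (hr : Injective r) (p : Fin q) (v : ℤ → ℝ) :
    (A.updateRow (r p) v).submatrix r c
      = (A.submatrix r c).updateRow p (fun x => v (c x)) := by
  ext a b
  by_cases h : a = p
  · subst h; simp
  · simp [updateRow_ne h, updateRow_ne (hr.ne h)]

theorem updateRow_submatrix_of_notMem (A : Matrix ℤ ℤ ℝ) {q : ℕ} {r : Fin q → ℤ} (c : Fin q → ℤ)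
    {k : ℤ} (hk : ∀ a, r a ≠ k) (v : ℤ → ℝ) :
    (A.updateRow k v).submatrix r c = A.submatrix r c := by
  ext a b
  simp [updateRow_ne (hk a)]

/-- Scaling a row by a nonnegative factor. -/
theorem TotallyNonneg.smul_row {A : Matrix ℤ ℤ ℝ} (hA : TotallyNonneg A) (k : ℤ) {s : ℝ}
    (hs : 0 ≤ s) : TotallyNonneg (A.updateRow k (s • A k)) := by
  intro q r c hr hc
  by_cases h : ∃ p, r p = k
  · obtain ⟨p, rfl⟩ := h
    rw [updateRow_submatrix_of_injective A c hr.injective]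
    have : (fun x => (s • A (r p)) (c x)) = s • (A.submatrix r c) p := by ext x; simp
    rw [this, det_updateRow_smul, updateRow_eq_self]
    exact mul_nonneg hs (hA q r c hr hc)
  · push Not at h
    rw [updateRow_submatrix_of_notMem A c h]
    exact hA q r c hr hc

theorem TotallyNonneg.zero_rows {A : Matrix ℤ ℤ ℝ} (hA : TotallyNonneg A) (s : Set ℤ)
    {B : Matrix ℤ ℤ ℝ} (hB : ∀ i, i ∈ s → B i = A i) (hB' : ∀ i, i ∉ s → B i = 0) :
    TotallyNonneg B := by
  intro q r c hr hc
  by_cases h : ∃ p, r p ∉ s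
  · obtain ⟨p, hp⟩ := h
    exact (det_eq_zero_of_row_eq_zero p (by simp [hB' _ hp])).ge
  · push Not at h
    have : B.submatrix r c = A.submatrix r c := by
      ext a b
      simp [hB _ (h a)]
    rw [this]
    exact hA q r c hr hc

/-- Adding to each row a nonnegative multiple of the next one. -/
theorem TotallyNonneg.add_next_row {A : Matrix ℤ ℤ ℝ} (hA : TotallyNonneg A) {a : ℤ → ℝ}
    (ha : ∀ i, 0 ≤ a i) :
    TotallyNonneg (Matrix.of fun i j => A i j + a i * A (i + 1) j) := by
  classical
  intro q r c hr hc
  let u : Fin q → Fin q → ℝ := fun p y => A (r p) (c y)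
  let v : Fin q → Fin q → ℝ := fun p => a (r p) • fun y => A (r p + 1) (c y)
  have key := (detRowAlternating (n := Fin q) (R := ℝ)).toMultilinearMap.map_add_univ u v
  have h1 : (Matrix.of fun i j => A i j + a i * A (i + 1) j).submatrix r c
      = (u + v : Fin q → Fin q → ℝ) := by
    ext x y
    simp [u, v]
  rw [h1]
  refine le_of_le_of_eq ?_ key.symm
  refine Finset.sum_nonneg fun s _ => ?_
  have h2 : s.piecewise u v
      = fun p => (if p ∈ s then (1 : ℝ) else a (r p)) •
        (fun y => A (if p ∈ s then r p else r p + 1) (c y)) := by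
    ext p y
    by_cases hp : p ∈ s <;> simp [hp, u, v]
  rw [h2, MultilinearMap.map_smul_univ]
  refine mul_nonneg (Finset.prod_nonneg fun p _ => ?_) ?_
  · split_ifs
    · exact zero_le_one
    · exact ha _
  -- Each chosen row is `r p` or `r p + 1`, and `r` increases strictly, so the chosen rows increase
  -- weakly: the determinant is a minor of `A`, or zero because of a repeated row.
  · refine hA.det_nonneg_of_monotone (r := fun p => if p ∈ s then r p else r p + 1) ?_ hc
    intro x y hxy
    rcases hxy.eq_or_lt with rfl | hlt
    · exact le_rfl
    · have := hr hlt
      dsimp only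
      split_ifs <;> omega

theorem totallyNonneg_one : TotallyNonneg (1 : Matrix ℤ ℤ ℝ) := by
  intro q r c hr hc
  by_cases h : ∃ p, ∀ x, r p ≠ c x
  · obtain ⟨p, hp⟩ := h
    exact (det_eq_zero_of_row_eq_zero p fun x => by simp [hp x]).ge
  · push Not at h
    have hrange : Set.range r = Set.range c := by
      have hsub : Set.range r ⊆ Set.range c := by
        rintro _ ⟨p, rfl⟩
        obtain ⟨x, hx⟩ := h p
        exact ⟨x, hx.symm⟩
      refine Set.eq_of_subset_of_ncard_le hsub ?_ (Set.finite_range c)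
      rw [← Set.image_univ, ← Set.image_univ, Set.ncard_image_of_injective _ hr.injective,
        Set.ncard_image_of_injective _ hc.injective]
    have hrc : r = c := (StrictMono.range_inj hr hc).1 hrange
    subst hrc
    rw [submatrix_one _ hr.injective]
    simp

/-! ### Neville elimination -/

/-- The hypotheses of Neville elimination of the entry `(k, j)` by means of row `k + 1`. -/
structure NevillePivot (A : Matrix ℤ ℤ ℝ) (k j : ℤ) : Prop where
  right : ∀ i j', i ≤ k + 1 → j < j' → A i j' = 0
  above : ∀ i, i < k → A i j = 0
  pos : 0 < A (k + 1) j

theorem strictMono_update_succ {q : ℕ} {r : Fin q → ℤ} (hr : StrictMono r) (p : Fin q)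
    (hp : ∀ a, r a ≠ r p + 1) : StrictMono (update r p (r p + 1)) := by
  intro a b hab
  have h := hr hab
  by_cases ha : a = p
  · subst ha
    have hb : b ≠ a := hab.ne'
    have := hp b
    simp only [update_self, update_of_ne hb]
    omega
  · by_cases hb : b = p
    · subst hb
      simp only [update_self, update_of_ne ha]
      omega
    · simpa only [update_of_ne ha, update_of_ne hb] using h

theorem det_updateRow_comb {q : ℕ} (M : Matrix (Fin q) (Fin q) ℝ) (p : Fin q) (s t : ℝ)
    (u v : Fin q → ℝ) :
    (M.updateRow p (s • u - t • v)).det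
      = s * (M.updateRow p u).det - t * (M.updateRow p v).det := by
  rw [sub_eq_add_neg, ← neg_smul, det_updateRow_add, det_updateRow_smul, det_updateRow_smul]
  ring

/-- If all columns lie left of `j`, append row `k + 1` and column `j`: the new column is zero except
in its last two entries, and expanding the larger minor along it gives the inequality. If the last
column is at least `j`, the combination of rows `k` and `k + 1` that kills column `j` makes the
whole last column zero, and equality holds. -/
theorem NevillePivot.minor_le_of_last {A : Matrix ℤ ℤ ℝ} (hA : TotallyNonneg A) {k j : ℤ}
    (h : NevillePivot A k j) {q : ℕ} {r c : Fin (q + 1) → ℤ} (hr : StrictMono r)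
    (hc : StrictMono c) (hk : r (Fin.last q) = k) :
    A k j * (A.submatrix (update r (Fin.last q) (k + 1)) c).det
      ≤ A (k + 1) j * (A.submatrix r c).det := by
  have hlt : ∀ a, a ≠ Fin.last q → r a < k := fun a ha => hk ▸ hr (Fin.lt_last_iff_ne_last.2 ha)
  rcases lt_or_ge (c (Fin.last q)) j with hcj | hcj
  · have hr' : StrictMono (Fin.snoc r (k + 1) : Fin (q + 2) → ℤ) := by
      rw [Fin.strictMono_iff_lt_succ]
      intro i
      induction i using Fin.lastCases with
      | last => simp [hk]
      | cast i =>
        rw [Fin.snoc_castSucc, ← Fin.castSucc_succ, Fin.snoc_castSucc]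
        exact hr (Fin.castSucc_lt_succ)
    have hc' : StrictMono (Fin.snoc c j : Fin (q + 2) → ℤ) := by
      rw [Fin.strictMono_iff_lt_succ]
      intro i
      induction i using Fin.lastCases with
      | last => simpa using hcj
      | cast i =>
        rw [Fin.snoc_castSucc, ← Fin.castSucc_succ, Fin.snoc_castSucc]
        exact hc (Fin.castSucc_lt_succ)
    have hdet := hA _ _ _ hr' hc'
    rw [det_succ_column _ (Fin.last (q + 1)), Fin.sum_univ_castSucc, Fin.sum_univ_castSucc,
      Finset.sum_eq_zero] at hdet
    · have e1 : (Fin.snoc r (k + 1) : Fin (q + 2) → ℤ) ∘ (Fin.last q).castSucc.succAbove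
          = update r (Fin.last q) (k + 1) := by
        ext i
        induction i using Fin.lastCases with
        | last => simp
        | cast i =>
          have : (Fin.last q).castSucc.succAbove i.castSucc = i.castSucc.castSucc :=
            Fin.succAbove_of_castSucc_lt _ _ (by simp [Fin.lt_def])
          simp [this, Fin.ne_of_lt (Fin.castSucc_lt_last i)]
      have e2 : (Fin.snoc r (k + 1) : Fin (q + 2) → ℤ) ∘ (Fin.last (q + 1)).succAbove = r := by
        ext i; simp
      have e3 : (Fin.snoc c j : Fin (q + 2) → ℤ) ∘ (Fin.last (q + 1)).succAbove = c := by
        ext i; simp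
      rw [submatrix_submatrix, submatrix_submatrix, e1, e2, e3] at hdet
      simp only [submatrix_apply, Fin.snoc_last, Fin.snoc_castSucc, hk, Fin.val_last,
        Fin.val_castSucc] at hdet
      have s1 : (-1 : ℝ) ^ (q + (q + 1)) = -1 := Odd.neg_one_pow ⟨q, by ring⟩
      have s2 : (-1 : ℝ) ^ (q + 1 + (q + 1)) = 1 := Even.neg_one_pow ⟨q + 1, rfl⟩
      rw [s1, s2] at hdet
      linarith
    · intro i _
      have : A (r i.castSucc) j = 0 := h.above _ (hlt _ (Fin.ne_of_lt (Fin.castSucc_lt_last i)))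
      simp [this]
  · have hz : ∀ i, i < k → A i (c (Fin.last q)) = 0 := by
      intro i hi
      rcases hcj.eq_or_lt with e | e
      · rw [← e]; exact h.above i hi
      · exact h.right i _ (by omega) e
    have hz' : A (k + 1) j * A k (c (Fin.last q)) - A k j * A (k + 1) (c (Fin.last q)) = 0 := by
      rcases hcj.eq_or_lt with e | e
      · rw [← e]; ring
      · rw [h.right k _ (by omega) e, h.right (k + 1) _ le_rfl e]; ring
    have hG : A.submatrix r c
        = (A.submatrix r c).updateRow (Fin.last q) (fun x => A k (c x)) := by
      rw [← submatrix_update, ← hk, update_eq_self]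
    have hd := det_updateRow_comb (A.submatrix r c) (Fin.last q) (A (k + 1) j) (A k j)
      (fun x => A k (c x)) (fun x => A (k + 1) (c x))
    rw [← hG, ← submatrix_update] at hd
    rw [det_eq_zero_of_column_eq_zero (Fin.last q)] at hd
    · linarith
    · intro i
      by_cases hi : i = Fin.last q
      · subst hi; simpa using hz'
      · rw [updateRow_ne hi]
        exact hz _ (hlt i hi)

theorem updateRow_adjacent_det (M : Matrix ℤ ℤ ℝ) {q : ℕ} (r c : Fin (q + 1) → ℤ) (p : Fin q)
    (k l : ℤ) :
    (M.submatrix (update (update r p.castSucc k) p.succ l) c).det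
      = -(M.submatrix (update (update r p.castSucc l) p.succ k) c).det := by
  have hne : p.castSucc ≠ p.succ := Fin.castSucc_lt_succ.ne
  have h := det_permute (Equiv.swap p.castSucc p.succ)
    (M.submatrix (update (update r p.castSucc l) p.succ k) c)
  rw [Equiv.Perm.sign_swap hne, submatrix_submatrix] at h
  have e : (update (update r p.castSucc l) p.succ k) ∘ (Equiv.swap p.castSucc p.succ)
      = update (update r p.castSucc k) p.succ l := by
    ext x
    by_cases h1 : x = p.castSucc
    · subst h1; simp [hne]
    · by_cases h2 : x = p.succ
      · subst h2; simp [hne]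
      · simp [Equiv.swap_apply_of_ne_of_ne h1 h2, h1, h2]
  rw [e] at h
  simpa using h

/-- Cramer's rule applied to a matrix with one row replaced, as a relation between minors. -/
theorem det_mul_det_replace {q : ℕ} (M : Matrix (Fin (q + 1)) (Fin (q + 1)) ℝ)
    (v : Fin (q + 1) → ℝ) (p : Fin q) (d : Fin q → Fin (q + 1)) :
    M.det * ((M.updateRow p.castSucc v).submatrix p.succ.succAbove d).det
      = (M.updateRow p.castSucc v).det * (M.submatrix p.succ.succAbove d).det
        + (M.updateRow p.succ v).det * (M.submatrix p.castSucc.succAbove d).det := by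
  have hne : p.castSucc ≠ p.succ := Fin.castSucc_lt_succ.ne
  have hp : p.succ.succAbove p = p.castSucc := Fin.succAbove_succ_self p
  set N := M.submatrix p.succ.succAbove d with hN
  have hrow : ∀ u : Fin (q + 1) → ℝ,
      (M.updateRow p.castSucc u).submatrix p.succ.succAbove d
        = N.updateRow p (fun x => u (d x)) := by
    intro u
    ext a b
    by_cases ha : a = p
    · subst ha; simp [hp]
    · have : p.succ.succAbove a ≠ p.castSucc := by
        rw [← hp]; exact fun h => ha (Fin.succAbove_right_injective h)
      simp [updateRow_ne ha, updateRow_ne this, hN]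
  -- Cramer: `v` times `det M` is a combination of the rows of `M`. Substituted in row `p` of the
  -- smaller minor, every row already present there contributes zero, so only the rows `p.castSucc`
  -- and `p.succ` survive.
  have hsum : M.det • (fun x => v (d x))
      = ∑ t, (M.updateRow t v).det • (fun x => M t (d x)) := by
    have h := mulVec_cramer Mᵀ v
    ext x
    have hx := congrFun h (d x)
    simp only [mulVec, dotProduct, transpose_apply, cramer_transpose_apply, det_transpose,
      Pi.smul_apply, smul_eq_mul] at hx
    simp only [Pi.smul_apply, smul_eq_mul, Finset.sum_apply]
    rw [← hx]
    exact Finset.sum_congr rfl fun t _ => mul_comm _ _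
  have hlin : M.det * (N.updateRow p (fun x => v (d x))).det
      = ∑ t, (M.updateRow t v).det * (N.updateRow p (fun x => M t (d x))).det := by
    rw [← det_updateRow_smul, hsum]
    have := map_sum ((detRowAlternating (n := Fin q) (R := ℝ)).toMultilinearMap.toLinearMap N p)
      (fun t => (M.updateRow t v).det • (fun x => M t (d x))) Finset.univ
    simp only [map_smul, smul_eq_mul] at this
    exact this
  rw [hrow, hlin, Finset.sum_eq_add_of_mem p.castSucc p.succ (Finset.mem_univ _)
    (Finset.mem_univ _) hne]
  · congr 1
    · congr 2
      have : (fun x => M p.castSucc (d x)) = N p := by ext x; simp [hN, hp]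
      rw [this, updateRow_eq_self]
    · congr 2
      ext a b
      by_cases ha : a = p
      · subst ha; simp [Fin.succAbove_castSucc_self]
      · have : p.succ.succAbove a = p.castSucc.succAbove a := by
          have ha' : (a : ℕ) ≠ p := fun h => ha (Fin.ext h)
          simp only [Fin.succAbove, Fin.lt_def, Fin.val_castSucc, Fin.val_succ]
          split_ifs <;> first | rfl | omega
        simp [updateRow_ne ha, hN, this]
  · intro t _ ht
    obtain ⟨b, rfl⟩ : ∃ b, p.succ.succAbove b = t := Fin.exists_succAbove_eq ht.2
    have hb : b ≠ p := fun h => ht.1 (by rw [h, hp])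
    have : (fun x => M (p.succ.succAbove b) (d x)) = N b := by ext x; simp [hN]
    rw [this, det_updateRow_eq_zero hb, mul_zero]

/-- Induction on the number `d` of chosen rows below row `k`. Deleting the row after `k` and a
suitable column gives a smaller instance, and the relation `det_mul_det_replace` transfers the
inequality back. -/
theorem NevillePivot.minor_le {A : Matrix ℤ ℤ ℝ} (hA : TotallyNonneg A) {k j : ℤ}
    (h : NevillePivot A k j) (d : ℕ) : ∀ {q : ℕ} {r c : Fin (q + 1) → ℤ} (p : Fin (q + 1)),
    StrictMono r → StrictMono c → r p = k → (∀ a, r a ≠ k + 1) → q = p + d →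
    A k j * (A.submatrix (update r p (k + 1)) c).det ≤ A (k + 1) j * (A.submatrix r c).det := by
  induction d with
  | zero =>
    intro q r c p hr hc hk _ hq
    obtain rfl : p = Fin.last q := Fin.ext (by simp [hq])
    exact h.minor_le_of_last hA hr hc hk
  | succ d ih =>
    intro q r c p hr hc hk hk' hq
    obtain ⟨q, rfl⟩ : ∃ q', q = q' + 1 := ⟨p + d, by omega⟩
    obtain ⟨p, rfl⟩ : ∃ p' : Fin (q + 1), p = p'.castSucc :=
      ⟨⟨p, by omega⟩, Fin.ext rfl⟩
    have hne : p.castSucc ≠ p.succ := Fin.castSucc_lt_succ.ne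
    have hmono := strictMono_update_succ hr p.castSucc (by rwa [hk])
    rw [hk] at hmono
    set M := A.submatrix (update r p.castSucc (k + 1)) c with hM
    have hMnonneg : 0 ≤ M.det := hA _ _ _ hmono hc
    have hG : A.submatrix r c = M.updateRow p.castSucc (fun x => A k (c x)) := by
      rw [hM, ← submatrix_update, update_idem, ← hk, update_eq_self]
    rcases hMnonneg.eq_or_lt with h0 | hpos
    · rw [← h0, mul_zero]
      exact mul_nonneg h.pos.le (hA _ _ _ hr hc)
    -- Laplace expansion along row `p.succ` of a nonzero determinant supplies a column whose
    -- deletion leaves a nonzero, hence positive, minor to divide by at the end.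
    have hex : ∃ y, (M.submatrix p.succ.succAbove (Fin.succAbove y)).det ≠ 0 := by
      by_contra hcon
      push Not at hcon
      refine hpos.ne' ?_
      rw [det_succ_row M p.succ]
      exact Finset.sum_eq_zero fun y _ => by rw [hcon y, mul_zero]
    obtain ⟨y, hy⟩ := hex
    have hp : p.succ.succAbove p = p.castSucc := Fin.succAbove_succ_self p
    have hD : StrictMono (c ∘ y.succAbove) := hc.comp (Fin.strictMono_succAbove y)
    have hF' : 0 < (M.submatrix p.succ.succAbove (Fin.succAbove y)).det := by
      refine lt_of_le_of_ne ?_ hy.symm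
      exact hA _ _ _ (hmono.comp (Fin.strictMono_succAbove _)) hD
    have hind := ih (r := r ∘ p.succ.succAbove) (c := c ∘ y.succAbove) p
      (hr.comp (Fin.strictMono_succAbove _)) hD (by simp [hp, hk]) (fun a => hk' _)
      (by simp at hq ⊢; omega)
    have e1 : update (r ∘ p.succ.succAbove) p (k + 1)
        = update r p.castSucc (k + 1) ∘ p.succ.succAbove := by
      rw [← hp, update_comp_eq_of_injective _ Fin.succAbove_right_injective]
    rw [e1, ← submatrix_submatrix, ← submatrix_submatrix, ← hM, hG] at hind
    have hpl := det_mul_det_replace M (fun x => A k (c x)) p y.succAbove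
    -- Here rows `k + 1` and `k` stand in the wrong order; swapping them turns this into minus a
    -- genuine minor of `A`.
    have hα : (M.updateRow p.succ (fun x => A k (c x))).det ≤ 0 := by
      rw [hM, ← submatrix_update, updateRow_adjacent_det, Left.neg_nonpos_iff]
      refine hA _ _ _ ?_ hc
      have hs : ∀ a, p.succ < a → k + 1 < r a := by
        intro a ha
        have h1 := hr (Fin.castSucc_lt_succ (i := p))
        have h2 := hr ha
        omega
      intro a b hab
      by_cases ha : a = p.succ
      · subst ha
        simpa [hab.ne'] using by
          rw [update_of_ne (fun h => by
            subst h; exact absurd (hab.trans Fin.castSucc_lt_succ) (lt_irrefl _))]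
          exact hs b hab
      · rw [update_of_ne ha, ← hk, update_eq_self]
        by_cases hb : b = p.succ
        · subst hb
          have : r a ≤ r p.castSucc := hr.monotone (Fin.le_castSucc_iff.2 hab)
          simp only [update_self]
          omega
        · rw [update_of_ne hb]
          exact hr hab
    have hβ : 0 ≤ (M.submatrix p.castSucc.succAbove (Fin.succAbove y)).det := 
      hA _ _ _ (hmono.comp (Fin.strictMono_succAbove _)) hD
    have hprod := mul_nonneg (neg_nonneg.2 hα) hβ
    rw [hG]
    set F := M.det
    set F' := (M.submatrix p.succ.succAbove (Fin.succAbove y)).det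
    set G := (M.updateRow p.castSucc (fun x => A k (c x))).det
    set G' := ((M.updateRow p.castSucc (fun x => A k (c x))).submatrix p.succ.succAbove
      (Fin.succAbove y)).det
    have h1 : F * G' ≤ G * F' := by linarith
    have h2 : (A k j * F) * F' ≤ (A (k + 1) j * G) * F' := by
      calc (A k j * F) * F' = F * (A k j * F') := by ring
        _ ≤ F * (A (k + 1) j * G') := mul_le_mul_of_nonneg_left hind hpos.le
        _ = A (k + 1) j * (F * G') := by ring
        _ ≤ A (k + 1) j * (G * F') := mul_le_mul_of_nonneg_left h1 h.pos.le
        _ = _ := by ring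
    exact le_of_mul_le_mul_right h2 hF'

/-- Neville elimination preserves total nonnegativity. -/
theorem TotallyNonneg.neville {A : Matrix ℤ ℤ ℝ} (hA : TotallyNonneg A) {k j : ℤ}
    (h : NevillePivot A k j) :
    TotallyNonneg (A.updateRow k (A k - (A k j / A (k + 1) j) • A (k + 1))) := by
  intro q r c hr hc
  by_cases hk : ∃ p, r p = k
  · obtain ⟨p, rfl⟩ := hk
    rw [updateRow_submatrix_of_injective A c hr.injective]
    have hd := det_updateRow_comb (A.submatrix r c) p 1 (A (r p) j / A (r p + 1) j)
      (fun x => A (r p) (c x)) (fun x => A (r p + 1) (c x))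
    rw [one_smul, ← submatrix_update, ← submatrix_update, update_eq_self, one_mul] at hd
    refine le_of_le_of_eq ?_ hd.symm
    by_cases hk' : ∃ b, r b = r p + 1
    · obtain ⟨b, hb⟩ := hk'
      have hbp : b ≠ p := by rintro rfl; omega
      have : (A.submatrix (update r p (r p + 1)) c).det = 0 := by
        refine det_zero_of_row_eq hbp ?_
        ext x
        simp [hbp, hb]
      rw [this, mul_zero, sub_zero]
      exact hA _ _ _ hr hc
    · push Not at hk'
      obtain ⟨q, rfl⟩ : ∃ q', q = q' + 1 := ⟨q - 1, by have := p.2; omega⟩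
      have := h.minor_le hA (q - p) p hr hc rfl hk' (by have := p.2; omega)
      rw [div_mul_eq_mul_div, sub_nonneg, div_le_iff₀ h.pos]
      linarith
  · push Not at hk
    rw [updateRow_submatrix_of_notMem A c hk]
    exact hA q r c hr hc

/-! ### Periodic band matrices and their last nonzero columns -/

/-- Unit upper triangular `n`-periodic matrices of finite bandwidth. -/
structure IsPeriodicBand (n : ℕ) (X : Matrix ℤ ℤ ℝ) : Prop where
  periodic : ∀ i j, X (i + n) (j + n) = X i j
  lower : ∀ i j, j < i → X i j = 0
  diag : ∀ i, X i i = 1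
  band : ∃ W : ℤ, ∀ i j, i + W < j → X i j = 0

theorem IsPeriodicBand.periodic_mul {n : ℕ} {X : Matrix ℤ ℤ ℝ} (hX : IsPeriodicBand n X)
    (i j t : ℤ) : X (i + n * t) (j + n * t) = X i j := by
  induction t using Int.induction_on with
  | zero => simp
  | succ t ih =>
    rw [← ih, ← hX.periodic (i + n * t)]
    congr 1 <;> ring
  | pred t ih =>
    rw [← ih, ← hX.periodic (i + n * (-t - 1))]
    congr 1 <;> ring

/-- `r i` is the last column in which row `i` of `X` is nonzero. -/
structure IsLastColumn (X : Matrix ℤ ℤ ℝ) (r : ℤ → ℤ) : Prop where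
  ne_zero : ∀ i, X i (r i) ≠ 0
  eq_zero : ∀ i j, r i < j → X i j = 0

theorem IsPeriodicBand.exists_isLastColumn {n : ℕ} {X : Matrix ℤ ℤ ℝ} (hX : IsPeriodicBand n X) :
    ∃ r, IsLastColumn X r := by
  obtain ⟨W, hW⟩ := hX.band
  have h : ∀ i, ∃ j, X i j ≠ 0 ∧ ∀ j', X i j' ≠ 0 → j' ≤ j := fun i =>
    Int.exists_greatest_of_bdd ⟨i + W, fun j hj => not_lt.1 fun h => hj (hW i j h)⟩
      ⟨i, by simp [hX.diag]⟩
  choose r hr using h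
  exact ⟨r, fun i => (hr i).1, fun i j hj => by_contra fun h => absurd ((hr i).2 j h) (by omega)⟩

theorem IsLastColumn.eq_of {X : Matrix ℤ ℤ ℝ} {r : ℤ → ℤ} (hr : IsLastColumn X r) {i j : ℤ}
    (h : X i j ≠ 0) (h' : ∀ j', j < j' → X i j' = 0) : r i = j := by
  rcases lt_trichotomy (r i) j with hlt | heq | hgt
  · exact absurd (hr.eq_zero i j hlt) h
  · exact heq
  · exact absurd (h' _ hgt) (hr.ne_zero i)

section LastColumn

variable {n : ℕ} {X : Matrix ℤ ℤ ℝ} {r : ℤ → ℤ}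

theorem IsLastColumn.le_self (hr : IsLastColumn X r) (hX : IsPeriodicBand n X) (i : ℤ) :
    i ≤ r i :=
  not_lt.1 fun h => hr.ne_zero i (hX.lower _ _ h)

theorem IsLastColumn.add_mul (hr : IsLastColumn X r) (hX : IsPeriodicBand n X) (i t : ℤ) :
    r (i + n * t) = r i + n * t := by
  refine hr.eq_of ?_ fun j' hj' => ?_
  · rw [hX.periodic_mul]
    exact hr.ne_zero i
  · have := hX.periodic_mul i (j' - n * t) t
    rw [sub_add_cancel] at this
    rw [this]
    exact hr.eq_zero _ _ (by omega)

/-- If `r (i + 1) < r i`, the minor on rows `i, i + 1` and columns `i + 1, r i` equals `-X i (r i)`,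
which is negative. -/
theorem IsLastColumn.monotone (hr : IsLastColumn X r) (hX : IsPeriodicBand n X)
    (hT : TotallyNonneg X) : Monotone r := by
  refine monotone_int_of_le_succ fun i => not_lt.1 fun h => ?_
  have h0 := hr.eq_zero (i + 1) (r i) h
  have h1 : i + 1 < r i := (hr.le_self hX (i + 1)).trans_lt h
  have := hT.mul_le_mul (lt_add_one i) h1
  rw [hX.diag, h0, mul_one, mul_zero] at this
  exact hr.ne_zero i (le_antisymm this (hT.entry_nonneg _ _))

/-- Over one period `r` rises by exactly `n` in `n` steps, each of size at least one; hence every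
step has size one. -/
theorem IsLastColumn.exists_eq_add (hr : IsLastColumn X r) (hX : IsPeriodicBand n X) (hn : 0 < n)
    (hs : ∀ k, r k < r (k + 1)) : ∃ w, ∀ i, r i = i + w := by
  have hstep : ∀ k (d : ℕ), r k + d ≤ r (k + d) := by
    intro k d
    induction d with
    | zero => simp
    | succ d ih =>
      have := hs (k + d)
      push_cast
      rw [← add_assoc, ← add_assoc]
      omega
  have hsucc : ∀ k, r (k + 1) = r k + 1 := by
    intro k
    have h1 := hstep (k + 1) (n - 1)
    have h2 := hr.add_mul hX k 1
    have h3 := hs k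
    rw [mul_one] at h2
    rw [show k + 1 + ((n - 1 : ℕ) : ℤ) = k + n by omega, h2] at h1
    omega
  refine ⟨r 0, fun i => ?_⟩
  induction i using Int.induction_on with
  | zero => simp
  | succ i ih => rw [hsucc, ih]; ring
  | pred i ih =>
    have := hsucc (-i - 1)
    rw [sub_add_cancel] at this
    omega

end LastColumn

/-! ### Splitting off a factor when two rows end in the same column -/

/-- `X` is the product of the periodic bidiagonal matrix with entries `a` and of `Y`, and `Y` is of
the same type as `X`, with fewer nonzero entries. -/
structure IsReduction (n : ℕ) (X : Matrix ℤ ℤ ℝ) (a : ℤ → ℝ) (Y : Matrix ℤ ℤ ℝ) : Prop where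
  nonneg : ∀ i, 0 ≤ a i
  periodic : ∀ i, a (i + n) = a i
  isPeriodicBand : IsPeriodicBand n Y
  totallyNonneg : TotallyNonneg Y
  eq : ∀ i j, X i j = Y i j + a i * Y (i + 1) j
  drop : ∃ i j, i < j ∧ X i j ≠ 0 ∧ Y i j = 0

section Chevalley

variable {n : ℕ} {X : Matrix ℤ ℤ ℝ} {r : ℤ → ℤ}

/-- Since `k` is the first row ending in column `r k`, all rows above vanish there, so row `k + 1`
is a Neville pivot for row `k`. The translates of `k` by multiples of `n` are treated one after
another, downwards; a window of rows meets only finitely many. -/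
theorem exists_reduction_of_eq (hX : IsPeriodicBand n X) (hT : TotallyNonneg X)
    (hr : IsLastColumn X r) {k : ℤ} (hk : r k = r (k + 1)) (hlt : ∀ i, i < k → r i < r k) :
    ∃ a Y, IsReduction n X a Y := by
  -- For `n = 1` periodicity would give `r (k + 1) = r k + 1`. So no two consecutive rows are
  -- modified, and the row subtracted is always a row of `X`.
  have hn : ¬ ((n : ℤ) ∣ 1) := by
    rintro ⟨t, ht⟩
    have := hr.add_mul hX k t
    rw [← ht, ← hk] at this
    omega
  have hmono := hr.monotone hX hT
  set a₀ := X k (r k) / X (k + 1) (r k) with ha₀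
  have ha₀pos : 0 ≤ a₀ := div_nonneg (hT.entry_nonneg _ _) (hT.entry_nonneg _ _)
  set a : ℤ → ℝ := fun i => if (n : ℤ) ∣ i - k then a₀ else 0 with ha
  set Y : Matrix ℤ ℤ ℝ := Matrix.of fun i j => X i j - a i * X (i + 1) j with hY
  have haper : ∀ i, a (i + n) = a i := by
    intro i
    simp only [ha, show i + (n : ℤ) - k = (i - k) + n by ring, dvd_add_self_right]
  have hYrow : ∀ i, ¬ ((n : ℤ) ∣ i - k) → Y i = X i := by
    intro i hi
    ext j
    simp [hY, ha, hi]
  have hYz : ∀ i j, r (i + 1) < j → Y i j = 0 := by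
    intro i j hj
    simp [hY, hr.eq_zero _ _ hj, hr.eq_zero i j ((hmono (by omega)).trans_lt hj)]
  refine ⟨a, Y, ?_, haper, ⟨?_, ?_, ?_, ?_⟩, ?_, ?_, k, r k, ?_, hr.ne_zero k, ?_⟩
  · intro i
    simp only [ha]
    split_ifs
    exacts [ha₀pos, le_rfl]
  · intro i j
    simp only [hY, of_apply, haper, hX.periodic,
      show i + (n : ℤ) + 1 = (i + 1) + n by ring]
  · intro i j hij
    simp [hY, hX.lower i j hij, hX.lower (i + 1) j (by omega)]
  · intro i
    simp [hY, hX.diag, hX.lower (i + 1) i (by omega)]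
  · obtain ⟨W, hW⟩ := hX.band
    refine ⟨W + 1, fun i j hij => hYz i j (lt_of_le_of_lt (not_lt.1 fun h => ?_) hij)⟩
    exact hr.ne_zero (i + 1) (hW _ _ (by omega))
  · refine TotallyNonneg.of_window fun lo hi => ?_
    -- `F t` has the rows `lo, …, lo + t - 1` already replaced by those of `Y`; the step to `F (t +
    -- 1)` is a Neville elimination or changes nothing.
    obtain ⟨F, hFY, hFX⟩ : ∃ F : ℕ → Matrix ℤ ℤ ℝ,
        (∀ (t : ℕ) (i : ℤ), lo ≤ i → i < lo + t → F t i = Y i) ∧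
          ∀ (t : ℕ) (i : ℤ), ¬(lo ≤ i ∧ i < lo + t) → F t i = X i :=
      ⟨fun t i => if lo ≤ i ∧ i < lo + t then Y i else X i, fun t i h h' => if_pos ⟨h, h'⟩,
        fun t i h => if_neg h⟩
    have hFsucc : ∀ (t : ℕ) (i : ℤ), i ≠ lo + t → F (t + 1) i = F t i := by
      intro t i hi
      by_cases h : lo ≤ i ∧ i < lo + t
      · rw [hFY _ _ h.1 h.2, hFY _ _ h.1 (by push_cast; omega)]
      · rw [hFX _ _ h, hFX _ _ (by push_cast; omega)]
    have hF : ∀ t : ℕ, TotallyNonneg (F t) := by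
      intro t
      induction t with
      | zero =>
        have : F 0 = X := funext fun i => hFX _ _ (by push_cast; omega)
        rwa [this]
      | succ t ih =>
        have hF0 : F t (lo + t) = X (lo + t) := hFX _ _ (by omega)
        have hF1 : F t (lo + t + 1) = X (lo + t + 1) := hFX _ _ (by omega)
        have hF2 : F (t + 1) (lo + t) = Y (lo + t) := hFY _ _ (by omega) (by push_cast; omega)
        by_cases hd : (n : ℤ) ∣ (lo + t) - k
        · obtain ⟨s, hs⟩ := hd
          have hk' : lo + t = k + n * s := by omega
          have hrk : r (lo + t) = r k + n * s := by rw [hk', hr.add_mul hX]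
          have hrk' : r (lo + t + 1) = r k + n * s := by
            rw [hk', show k + n * s + 1 = k + 1 + n * s by ring, hr.add_mul hX, hk]
          have hrlt : ∀ i, i < lo + t → r i < r k + n * s := by
            intro i hi
            have h1 := hlt (i - n * s) (by omega)
            have h2 := hr.add_mul hX (i - n * s) s
            rw [sub_add_cancel] at h2
            omega
          have hpiv : NevillePivot (F t) (lo + t) (r k + n * s) := by
            refine ⟨fun i j hi hj => ?_, fun i hi => ?_, ?_⟩
            · by_cases h : lo ≤ i ∧ i < lo + t
              · rw [hFY _ _ h.1 h.2]
                exact hYz i j (lt_of_le_of_lt (hmono (show i + 1 ≤ lo + t by omega))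
                  (by omega))
              · rw [hFX _ _ h]
                exact hr.eq_zero i j (lt_of_le_of_lt (hmono hi) (by omega))
            · by_cases h : lo ≤ i ∧ i < lo + t
              · rw [hFY _ _ h.1 h.2]
                by_cases hd : (n : ℤ) ∣ i - k
                · refine hYz i _ (hrlt _ ?_)
                  rcases (show i + 1 ≤ lo + t by omega).lt_or_eq with h' | h'
                  · exact h'
                  · refine absurd ?_ hn
                    have : (1 : ℤ) = n * s - (i - k) := by omega
                    rw [this]
                    exact dvd_sub (dvd_mul_right _ _) hd
                · rw [hYrow i hd]
                  exact hr.eq_zero i _ (hrlt i hi)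
              · rw [hFX _ _ h]
                exact hr.eq_zero i _ (hrlt i hi)
            · rw [hF1, ← hrk']
              exact lt_of_le_of_ne (hT.entry_nonneg _ _) (hr.ne_zero _).symm
          have := ih.neville hpiv
          refine (congrArg TotallyNonneg ?_).mpr this
          ext i j
          by_cases hi : i = lo + t
          · subst hi
            rw [updateRow_self, hF0, hF1, hF2]
            have e1 : X (lo + t) (r k + n * s) = X k (r k) := by rw [hk', hX.periodic_mul]
            have e2 : X (lo + t + 1) (r k + n * s) = X (k + 1) (r k) := by
              rw [hk', show k + n * s + 1 = k + 1 + n * s by ring, hX.periodic_mul]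
            have e3 : a (lo + t) = a₀ := if_pos ⟨s, hs⟩
            simp [hY, e1, e2, e3, ha₀]
          · rw [updateRow_ne hi, hFsucc _ _ hi]
        · refine (congrArg TotallyNonneg (funext fun i => ?_)).mpr ih
          by_cases hi : i = lo + t
          · subst hi
            rw [hF2, hF0, hYrow _ hd]
          · exact hFsucc _ _ hi
    refine ⟨_, hF (hi + 1 - lo).toNat, fun i h1 h2 => hFY _ _ h1 (by omega)⟩
  · intro i j
    by_cases hi : (n : ℤ) ∣ i - k
    · have : ¬ ((n : ℤ) ∣ i + 1 - k) := fun h => hn (by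
        have := dvd_sub h hi
        rwa [show i + 1 - k - (i - k) = 1 by ring] at this)
      rw [hYrow _ this]
      simp [hY]
    · rw [hYrow _ hi]
      simp [ha, hi]
  · have := hr.le_self hX (k + 1)
    omega
  · have h1 : X (k + 1) (r k) ≠ 0 := hk ▸ hr.ne_zero (k + 1)
    simp [hY, ha, ha₀, h1]

end Chevalley

/-! ### Splitting off a factor when the band has constant width: a limit of eliminations -/

section StrictBand

/-- `X` vanishes beyond the `w`-th superdiagonal and nowhere on it. -/
structure IsStrictBand (X : Matrix ℤ ℤ ℝ) (w : ℤ) : Prop where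
  pos : 0 < w
  lower : ∀ i j, j < i → X i j = 0
  diag : ∀ i, X i i = 1
  band : ∀ i j, i + w < j → X i j = 0
  ne_zero : ∀ i, X i (i + w) ≠ 0

/-- Row `i` of `bandElim X w m` arises from rows `i, …, i + m` of `X`: the last of these is truncated
to its first `w` entries, and then, going upwards, a multiple of each row is subtracted from the
previous one so as to eliminate the entry on the `w`-th superdiagonal. -/
noncomputable def bandElim (X : Matrix ℤ ℤ ℝ) (w : ℤ) : ℕ → Matrix ℤ ℤ ℝ
  | 0 => Matrix.of fun i j => if j < i + w then X i j else 0
  | m + 1 => Matrix.of fun i j =>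
      X i j - X i (i + w) / bandElim X w m (i + 1) (i + w) * bandElim X w m (i + 1) j

/-- Rows of `X` above row `i`, followed by rows `i, …, i + m` after elimination. -/
noncomputable def bandElimWindow (X : Matrix ℤ ℤ ℝ) (w : ℤ) (m : ℕ) (i : ℤ) : Matrix ℤ ℤ ℝ :=
  Matrix.of fun k =>
    if k < i then X k else if k ≤ i + m then bandElim X w (m - (k - i).toNat) k else 0

/-- Rows of `X` above row `i`, followed by row `i` of `bandElim X w (m + 1)` and by the difference
of row `i` of `bandElim X w m` and of `bandElim X w (m + 1)`. -/
noncomputable def bandElimDiff (X : Matrix ℤ ℤ ℝ) (w : ℤ) (m : ℕ) (i : ℤ) : Matrix ℤ ℤ ℝ :=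
  Matrix.of fun k =>
    if k < i then X k
    else if k = i then bandElim X w (m + 1) i
    else if k = i + 1 then bandElim X w m i - bandElim X w (m + 1) i
    else 0

variable {X : Matrix ℤ ℤ ℝ} {w : ℤ}

theorem bandElim_succ_row (m : ℕ) (i : ℤ) :
    bandElim X w (m + 1) i
      = X i - (X i (i + w) / bandElim X w m (i + 1) (i + w)) • bandElim X w m (i + 1) := by
  ext j
  simp [bandElim]

theorem IsStrictBand.bandElim_lower (hX : IsStrictBand X w) (m : ℕ) :
    ∀ i j, j < i → bandElim X w m i j = 0 := by
  induction m with
  | zero => intro i j h; simp [bandElim, hX.lower i j h]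
  | succ m ih => intro i j h; simp [bandElim, hX.lower i j h, ih (i + 1) j (by omega)]

theorem IsStrictBand.bandElim_diag (hX : IsStrictBand X w) (m : ℕ) (i : ℤ) :
    bandElim X w m i i = 1 := by
  cases m with
  | zero => simp [bandElim, hX.diag, hX.pos]
  | succ m => simp [bandElim, hX.diag, hX.bandElim_lower m (i + 1) i (by omega)]

theorem bandElimWindow_lt {m : ℕ} {i k : ℤ} (h : k < i) : bandElimWindow X w m i k = X k :=
  if_pos h

theorem bandElimWindow_mid {m : ℕ} {i k : ℤ} (h : i ≤ k) (h' : k ≤ i + m) :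
    bandElimWindow X w m i k = bandElim X w (m - (k - i).toNat) k := by
  show (if k < i then X k else if k ≤ i + m then _ else _) = _
  rw [if_neg (by omega), if_pos h']

theorem bandElimWindow_self (m : ℕ) (i : ℤ) : bandElimWindow X w m i i = bandElim X w m i := by
  rw [bandElimWindow_mid le_rfl (by omega)]
  simp

theorem bandElimWindow_gt {m : ℕ} {i k : ℤ} (h : i + m < k) : bandElimWindow X w m i k = 0 := by
  show (if k < i then X k else if k ≤ i + m then _ else _) = _
  rw [if_neg (by omega), if_neg (by omega)]

theorem bandElimDiff_lt {m : ℕ} {i k : ℤ} (h : k < i) : bandElimDiff X w m i k = X k :=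
  if_pos h

theorem bandElimDiff_self (m : ℕ) (i : ℤ) :
    bandElimDiff X w m i i = bandElim X w (m + 1) i := by
  show (if i < i then X i else if i = i then _ else _) = _
  rw [if_neg (by omega), if_pos rfl]

theorem bandElimDiff_succ (m : ℕ) (i : ℤ) :
    bandElimDiff X w m i (i + 1) = bandElim X w m i - bandElim X w (m + 1) i := by
  show (if i + 1 < i then _ else if i + 1 = i then _ else if i + 1 = i + 1 then _ else _) = _
  rw [if_neg (by omega), if_neg (by omega), if_pos rfl]

theorem bandElimDiff_gt {m : ℕ} {i k : ℤ} (h : i + 1 < k) : bandElimDiff X w m i k = 0 := by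
  show (if k < i then _ else if k = i then _ else if k = i + 1 then _ else _) = _
  rw [if_neg (by omega), if_neg (by omega), if_neg (by omega)]

/-- The entry used as a pivot is positive. -/
theorem IsStrictBand.bandElim_pivot_pos (hX : IsStrictBand X w) (hT : TotallyNonneg X) {m : ℕ}
    {i : ℤ} (h : TotallyNonneg (bandElimWindow X w m (i + 1))) :
    0 < bandElim X w m (i + 1) (i + w) := by
  rcases (show i + 1 ≤ i + w by have := hX.pos; omega).eq_or_lt with hw | hw
  · rw [← hw, hX.bandElim_diag]
    exact one_pos
  · have h2 := h.mul_le_mul (lt_add_one i) hw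
    rw [bandElimWindow_lt (lt_add_one i), bandElimWindow_self, hX.bandElim_diag, mul_one] at h2
    have h3 : 0 < X i (i + w) := lt_of_le_of_ne (hT.entry_nonneg _ _) (hX.ne_zero i).symm
    exact pos_of_mul_pos_right (h3.trans_le h2) (hT.entry_nonneg _ _)

/-- Clearing all columns from some point on. -/
theorem TotallyNonneg.truncate {A B : Matrix ℤ ℤ ℝ} (hA : TotallyNonneg A) (b : ℤ)
    (hB : ∀ i j, j < b → B i j = A i j) (hB' : ∀ i j, b ≤ j → B i j = 0) : TotallyNonneg B := by
  intro q r c hr hc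
  by_cases h : ∃ y, b ≤ c y
  · obtain ⟨y, hy⟩ := h
    exact (det_eq_zero_of_column_eq_zero y fun x => by simp [hB' _ _ hy]).ge
  · push Not at h
    have : B.submatrix r c = A.submatrix r c := by
      ext x y
      simp [hB _ _ (h y)]
    rw [this]
    exact hA q r c hr hc

/-- Rows above `i` already vanish from column `i + w` on, so truncating row `i` alone agrees with
clearing all those columns. -/
theorem IsStrictBand.window_zero (hX : IsStrictBand X w) (hT : TotallyNonneg X) (i : ℤ) :
    TotallyNonneg (bandElimWindow X w 0 i) := by
  have h1 : TotallyNonneg (Matrix.of fun k j => if j < i + w then X k j else 0) :=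
    hT.truncate (i + w) (fun k j h => by simp [h]) (fun k j h => by simp [not_lt.2 h])
  refine h1.zero_rows {k | k ≤ i} (fun k hk => ?_) (fun k hk => bandElimWindow_gt (by
    simp at hk ⊢; omega))
  rcases (show k ≤ i from hk).lt_or_eq with h | rfl
  · rw [bandElimWindow_lt h]
    ext j
    by_cases hj : j < i + w
    · simp [hj]
    · simp [hj, hX.band k j (by omega)]
  · rw [bandElimWindow_self]
    ext j
    simp [bandElim]

/-- The matrices of the elimination vanish from the `w`-th superdiagonal on, and they are totally
nonnegative. -/
theorem IsStrictBand.window (hX : IsStrictBand X w) (hT : TotallyNonneg X) (m : ℕ) :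
    (∀ i j, i + w ≤ j → bandElim X w m i j = 0) ∧
      ∀ i, TotallyNonneg (bandElimWindow X w m i) := by
  induction m with
  | zero =>
    refine ⟨fun i j h => ?_, hX.window_zero hT⟩
    simp [bandElim, not_lt.2 h]
  | succ m ih =>
    have hp : ∀ i, 0 < bandElim X w m (i + 1) (i + w) :=
      fun i => hX.bandElim_pivot_pos hT (ih.2 (i + 1))
    refine ⟨fun i j h => ?_, fun i => ?_⟩
    · rcases h.eq_or_lt with rfl | h
      · simp [bandElim, (hp i).ne']
      · simp [bandElim, hX.band i j h, ih.1 (i + 1) j (by omega)]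
    · have hpiv : NevillePivot (bandElimWindow X w m (i + 1)) i (i + w) := by
        refine ⟨fun k j hk hj => ?_, fun k hk => ?_, ?_⟩
        · rcases hk.lt_or_eq with h | rfl
          · rw [bandElimWindow_lt h]
            exact hX.band k j (by omega)
          · rw [bandElimWindow_self]
            exact ih.1 _ _ (by omega)
        · rw [bandElimWindow_lt (by omega)]
          exact hX.band k _ (by omega)
        · rw [bandElimWindow_self]
          exact hp i
      have := (ih.2 (i + 1)).neville hpiv
      rw [bandElimWindow_lt (lt_add_one i), bandElimWindow_self, ← bandElim_succ_row] at this
      refine (congrArg TotallyNonneg (funext fun k => ?_)).mpr this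
      rcases lt_trichotomy k i with h | rfl | h
      · rw [updateRow_ne h.ne, bandElimWindow_lt h, bandElimWindow_lt (by omega)]
      · rw [updateRow_self, bandElimWindow_self]
      · rw [updateRow_ne h.ne']
        by_cases hk : k ≤ i + 1 + m
        · rw [bandElimWindow_mid h.le (by push_cast; omega), bandElimWindow_mid (by omega) hk]
          congr 1
          omega
        · rw [bandElimWindow_gt (by push_cast; omega), bandElimWindow_gt (by omega)]

/-- Left of column `i + w` the difference row is a nonnegative multiple of the truncated row `i +
1`, so the matrix is a rescaled and truncated `bandElimWindow X w 1 i`. -/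
theorem IsStrictBand.diff_zero (hX : IsStrictBand X w) (hT : TotallyNonneg X) (i : ℤ) :
    TotallyNonneg (bandElimDiff X w 0 i) := by
  have hW := hX.window hT
  set s := X i (i + w) / bandElim X w 0 (i + 1) (i + w) with hs
  have hp : 0 < bandElim X w 0 (i + 1) (i + w) := hX.bandElim_pivot_pos hT ((hW 0).2 (i + 1))
  have hs0 : 0 ≤ s := div_nonneg (hT.entry_nonneg _ _) hp.le
  have h1 := ((hW 1).2 i).smul_row (i + 1) hs0
  have h2 : bandElimWindow X w 1 i (i + 1) = bandElim X w 0 (i + 1) := by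
    rw [bandElimWindow_mid (by omega) (by simp)]
    simp
  rw [h2] at h1
  refine h1.truncate (i + w) (fun k j hj => ?_) (fun k j hj => ?_)
  · rcases lt_trichotomy k i with h | rfl | h
    · rw [updateRow_ne (by omega), bandElimDiff_lt h, bandElimWindow_lt h]
    · rw [updateRow_ne (by omega), bandElimDiff_self, bandElimWindow_self]
    · rcases (show i + 1 ≤ k from h).eq_or_lt with rfl | h
      · rw [updateRow_self, bandElimDiff_succ, bandElim_succ_row]
        simp [bandElim, hj, hs]
      · rw [updateRow_ne (by omega), bandElimDiff_gt h, bandElimWindow_gt (by simpa using h)]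
  · rcases lt_trichotomy k i with h | rfl | h
    · rw [bandElimDiff_lt h]
      exact hX.band k j (by omega)
    · rw [bandElimDiff_self]
      exact (hW 1).1 k j hj
    · rcases (show i + 1 ≤ k from h).eq_or_lt with rfl | h
      · rw [bandElimDiff_succ]
        simp [(hW 0).1 i j hj, (hW 1).1 i j hj]
      · rw [bandElimDiff_gt h]
        rfl

/-- Only nonnegativity of the difference row is needed later, but the induction requires the whole
matrix to be totally nonnegative. One Neville step at row `i` passes from the matrix for `i + 1` to
one with rows `bandElim X w (m + 2) i`, `bandElim X w (m + 1) (i + 1)` and `e`. Unless `e = 0`, the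
new difference row is a nonnegative multiple of what a second Neville step, with pivot row `e`,
makes of the middle row. -/
theorem IsStrictBand.diff (hX : IsStrictBand X w) (hT : TotallyNonneg X) (m : ℕ) :
    ∀ i, TotallyNonneg (bandElimDiff X w m i) := by
  have hW := hX.window hT
  have hp : ∀ m i, 0 < bandElim X w m (i + 1) (i + w) :=
    fun m i => hX.bandElim_pivot_pos hT ((hW m).2 (i + 1))
  induction m with
  | zero => exact hX.diff_zero hT
  | succ m ih =>
    intro i
    set e : ℤ → ℝ := bandElim X w m (i + 1) - bandElim X w (m + 1) (i + 1) with he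
    have hez : ∀ j, i + 1 + w ≤ j → e j = 0 := by
      intro j hj
      simp [he, (hW m).1 _ j hj, (hW (m + 1)).1 _ j hj]
    have hpiv : NevillePivot (bandElimDiff X w m (i + 1)) i (i + w) := by
      refine ⟨fun k j hk hj => ?_, fun k hk => ?_, ?_⟩
      · rcases hk.lt_or_eq with h | rfl
        · rw [bandElimDiff_lt h]
          exact hX.band k j (by omega)
        · rw [bandElimDiff_self]
          exact (hW (m + 1)).1 _ _ (by omega)
      · rw [bandElimDiff_lt (by omega)]
        exact hX.band k _ (by omega)
      · rw [bandElimDiff_self]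
        exact hp (m + 1) i
    have h1 := (ih (i + 1)).neville hpiv
    rw [bandElimDiff_lt (lt_add_one i), bandElimDiff_self, ← bandElim_succ_row] at h1
    obtain ⟨A, hA, hAlt, hA0, hA1, hA2⟩ : ∃ A : Matrix ℤ ℤ ℝ, TotallyNonneg A ∧
        (∀ k, k < i → A k = X k) ∧ A i = bandElim X w (m + 2) i ∧
        A (i + 1) = bandElim X w (m + 1) (i + 1) ∧ A (i + 1 + 1) = e := by
      refine ⟨_, h1, fun k hk => ?_, updateRow_self, ?_, ?_⟩
      · rw [updateRow_ne hk.ne, bandElimDiff_lt (by omega)]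
      · rw [updateRow_ne (by omega), bandElimDiff_self]
      · rw [updateRow_ne (by omega), bandElimDiff_succ]
    have hrow : bandElim X w (m + 1) i - bandElim X w (m + 2) i
        = (X i (i + w) / bandElim X w (m + 1) (i + 1) (i + w)) • bandElim X w (m + 1) (i + 1)
          - (X i (i + w) / bandElim X w m (i + 1) (i + w)) • bandElim X w m (i + 1) := by
      rw [bandElim_succ_row m i, bandElim_succ_row (m + 1) i]
      abel
    have hx : 0 ≤ X i (i + w) := hT.entry_nonneg _ _
    have hzm := hp m i
    have hzm' := hp (m + 1) i
    have hee : e (i + w) = bandElim X w m (i + 1) (i + w) - bandElim X w (m + 1) (i + 1) (i + w) :=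
      rfl
    rcases (show 0 ≤ e (i + w) by rw [← hA2]; exact hA.entry_nonneg _ _).eq_or_lt with h0 | hpos
    · have he0 : e = 0 := by
        ext j
        rcases lt_trichotomy j (i + w) with hj | rfl | hj
        -- As `e (i + w) = 0`, this minor bounds the positive pivot `bandElim X w (m + 1) (i + 1) (i
        -- + w)` times `e j` by zero.
        · have h2 := hA.mul_le_mul (lt_add_one (i + 1)) hj
          rw [hA1, hA2, ← h0, mul_zero] at h2
          refine le_antisymm (nonpos_of_mul_nonpos_right h2 hzm') ?_
          rw [← hA2]
          exact hA.entry_nonneg _ _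
        · exact h0.symm
        · exact hez j (by omega)
      have hmm : bandElim X w m (i + 1) = bandElim X w (m + 1) (i + 1) := sub_eq_zero.1 he0
      rw [hmm, sub_self] at hrow
      refine hA.zero_rows {k | k ≤ i} (fun k hk => ?_) (fun k hk => ?_)
      · rcases (show k ≤ i from hk).lt_or_eq with h | rfl
        · rw [bandElimDiff_lt h, hAlt k h]
        · rw [bandElimDiff_self, hA0]
      · have hk : i < k := not_le.1 hk
        rcases (show i + 1 ≤ k from hk).eq_or_lt with rfl | h
        · rw [bandElimDiff_succ, hrow]
        · exact bandElimDiff_gt h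
    · have hpiv' : NevillePivot A (i + 1) (i + w) := by
        refine ⟨fun k j hk hj => ?_, fun k hk => ?_, ?_⟩
        · rcases lt_trichotomy k i with h | rfl | h
          · rw [hAlt k h]
            exact hX.band k j (by omega)
          · rw [hA0]
            exact (hW (m + 2)).1 _ _ hj.le
          · rcases (show i + 1 ≤ k from h).eq_or_lt with rfl | h
            · rw [hA1]
              exact (hW (m + 1)).1 _ _ (by omega)
            · obtain rfl : k = i + 1 + 1 := by omega
              rw [hA2]
              exact hez j (by omega)
        · rcases (show k ≤ i by omega).lt_or_eq with h | rfl
          · rw [hAlt k h]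
            exact hX.band k _ (by omega)
          · rw [hA0]
            exact (hW (m + 2)).1 _ _ le_rfl
        · rw [hA2]
          exact hpos
      -- In `hrow`, write row `i + 1` of `bandElim X w m` as that of `bandElim X w (m + 1)` plus
      -- `e`; `s` is the resulting coefficient of the latter row. It is nonnegative since the pivots
      -- decrease with `m`.
      set s := X i (i + w) / bandElim X w (m + 1) (i + 1) (i + w)
        - X i (i + w) / bandElim X w m (i + 1) (i + w) with hs
      have hs0 : 0 ≤ s := by
        rw [hs, sub_nonneg]
        exact div_le_div_of_nonneg_left hx hzm' (by linarith)
      have h3 := (hA.neville hpiv').smul_row (i + 1) hs0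
      rw [updateRow_self, hA1, hA2] at h3
      refine h3.zero_rows {k | k ≤ i + 1} (fun k hk => ?_) (fun k hk => ?_)
      · rcases lt_trichotomy k i with h | rfl | h
        · rw [updateRow_ne (by omega), updateRow_ne (by omega), bandElimDiff_lt h, hAlt k h]
        · rw [updateRow_ne (by omega), updateRow_ne (by omega), bandElimDiff_self, hA0]
        · obtain rfl : k = i + 1 := le_antisymm hk h
          rw [updateRow_self, bandElimDiff_succ, hrow]
          have hkey : s * (bandElim X w (m + 1) (i + 1) (i + w) / e (i + w))
              = X i (i + w) / bandElim X w m (i + 1) (i + w) := by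
            have := hpos.ne'
            rw [hee] at this
            rw [hs, hee]
            field_simp
          rw [smul_sub, smul_smul, hkey, he, hs]
          ext j
          simp only [Pi.sub_apply, Pi.smul_apply, smul_eq_mul]
          ring
      · exact bandElimDiff_gt (not_le.1 hk)

theorem IsStrictBand.bandElim_antitone (hX : IsStrictBand X w) (hT : TotallyNonneg X) (i j : ℤ) :
    Antitone fun m => bandElim X w m i j := by
  refine antitone_nat_of_succ_le fun m => ?_
  have := (hX.diff hT m i).entry_nonneg (i + 1) j
  rw [bandElimDiff_succ] at this
  simpa using this

/-- The entries decrease in `m` and are nonnegative, so they converge. Periodicity, total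
nonnegativity and the recursion pass to the limit, and the recursion becomes the factorization. -/
theorem exists_reduction_of_strictBand {n : ℕ} (hP : IsPeriodicBand n X) (hT : TotallyNonneg X)
    (hX : IsStrictBand X w) : ∃ a Y, IsReduction n X a Y := by
  have hW := hX.window hT
  have hpos : ∀ m i j, 0 ≤ bandElim X w m i j := by
    intro m i j
    rw [← bandElimWindow_self]
    exact ((hW m).2 i).entry_nonneg i j
  have hlim : ∀ i j, ∃ y, Tendsto (fun m => bandElim X w m i j) atTop (𝓝 y) := fun i j =>
    ⟨_, tendsto_atTop_ciInf (hX.bandElim_antitone hT i j)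
      ⟨0, by rintro _ ⟨m, rfl⟩; exact hpos m i j⟩⟩
  choose Y hY using hlim
  have hYeq : ∀ {i j : ℤ} {y : ℝ}, (∀ m, bandElim X w m i j = y) → Y i j = y := by
    intro i j y h
    refine tendsto_nhds_unique (hY i j) ?_
    simp only [h]
    exact tendsto_const_nhds
  have hbper : ∀ m i j, bandElim X w m (i + n) (j + n) = bandElim X w m i j := by
    intro m
    induction m with
    | zero =>
      intro i j
      simp only [bandElim, of_apply, hP.periodic]
      exact if_congr (by omega) rfl rfl
    | succ m ih =>
      intro i j
      simp only [bandElim, of_apply, hP.periodic, show i + (n : ℤ) + 1 = i + 1 + n by ring, ih,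
        show i + (n : ℤ) + w = i + w + n by ring]
  have hYper : ∀ i j, Y (i + n) (j + n) = Y i j := by
    intro i j
    refine tendsto_nhds_unique (hY (i + n) (j + n)) ?_
    simp only [hbper]
    exact hY i j
  have hdiag : ∀ i, Y i i = 1 := fun i => hYeq fun m => hX.bandElim_diag m i
  set a : ℤ → ℝ := fun i => X i (i + 1) - Y i (i + 1) with ha
  have hcoef : ∀ i, Tendsto (fun m => X i (i + w) / bandElim X w m (i + 1) (i + w)) atTop
      (𝓝 (a i)) := by
    intro i
    -- Reading the recursion in column `i + 1`, where the subtracted row has entry one, expresses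
    -- the multiplier without division; it converges with no lower bound on the pivots.
    have h1 : ∀ m, X i (i + w) / bandElim X w m (i + 1) (i + w)
        = X i (i + 1) - bandElim X w (m + 1) i (i + 1) := by
      intro m
      rw [bandElim_succ_row]
      simp [hX.bandElim_diag]
    simp only [h1]
    exact tendsto_const_nhds.sub ((hY i (i + 1)).comp (tendsto_add_atTop_nat 1))
  have hTY : TotallyNonneg Y := by
    have h1 : ∀ i, TotallyNonneg (fun k => if k < i then X k else Y k : Matrix ℤ ℤ ℝ) := by
      intro i
      refine TotallyNonneg.of_tendsto (fun m => (hW m).2 i) fun k j => ?_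
      by_cases hk : k < i
      · simp only [if_pos hk, bandElimWindow_lt hk]
        exact tendsto_const_nhds
      · simp only [if_neg hk]
        rw [← tendsto_add_atTop_iff_nat (k - i).toNat]
        refine (hY k j).congr fun m => ?_
        rw [bandElimWindow_mid (not_lt.1 hk) (by push_cast; omega), Nat.add_sub_cancel]
    exact TotallyNonneg.of_window fun lo hi => ⟨_, h1 lo, fun i h _ => if_neg (not_lt.2 h)⟩
  refine ⟨a, Y, ?_, ?_, ⟨hYper, ?_, hdiag, w, ?_⟩, hTY, ?_, 0, 0 + w, ?_, hX.ne_zero 0, ?_⟩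
  · intro i
    exact ge_of_tendsto' (hcoef i) fun m => div_nonneg (hT.entry_nonneg _ _) (hpos _ _ _)
  · intro i
    simp only [ha, show i + (n : ℤ) + 1 = i + 1 + n by ring, hP.periodic, hYper]
  · exact fun i j h => hYeq fun m => hX.bandElim_lower m i j h
  · exact fun i j h => hYeq fun m => (hW m).1 i j h.le
  · intro i j
    have h1 := ((hY i j).comp (tendsto_add_atTop_nat 1)).add ((hcoef i).mul (hY (i + 1) j))
    refine tendsto_nhds_unique (tendsto_const_nhds.congr fun m => ?_) h1
    simp [bandElim_succ_row]
  · have := hX.pos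
    omega
  · exact hYeq fun m => (hW m).1 0 _ le_rfl

end StrictBand

theorem exists_reduction {n : ℕ} {X : Matrix ℤ ℤ ℝ} (hn : 0 < n) (hX : IsPeriodicBand n X)
    (hT : TotallyNonneg X) (hne : ∃ i j, i < j ∧ X i j ≠ 0) : ∃ a Y, IsReduction n X a Y := by
  obtain ⟨r, hr⟩ := hX.exists_isLastColumn
  have hmono := hr.monotone hX hT
  by_cases h : ∃ k, r (k + 1) ≤ r k
  · obtain ⟨k₀, hk₀⟩ := h
    obtain ⟨W, hW⟩ := hX.band
    obtain ⟨k, hk, hmin⟩ := Int.exists_least_of_bdd (P := fun i => r i = r k₀)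
      ⟨r k₀ - W, fun i hi => not_lt.1 fun h => hr.ne_zero i (by
        rw [hi]; exact hW _ _ (by omega))⟩ ⟨k₀, rfl⟩
    refine exists_reduction_of_eq hX hT hr (k := k) (le_antisymm (hmono (by omega)) ?_) ?_
    · rw [hk]
      exact (hmono (by have := hmin k₀ rfl; omega)).trans hk₀
    · intro i hi
      refine lt_of_le_of_ne (hmono hi.le) fun h => ?_
      have := hmin i (h.trans hk)
      omega
  · push Not at h
    obtain ⟨w, hw⟩ := hr.exists_eq_add hX hn h
    refine exists_reduction_of_strictBand (w := w) hX hT ⟨?_, hX.lower, hX.diag, ?_, ?_⟩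
    · obtain ⟨i, j, hij, hne⟩ := hne
      by_contra hw0
      exact hne (hr.eq_zero i j (by rw [hw]; omega))
    · exact fun i j h => hr.eq_zero i j (by rwa [hw])
    · exact fun i => hw i ▸ hr.ne_zero i

/-! ### Matrix polynomials and periodic band matrices -/

section Toeplitz

variable {n : ℕ} [NeZero n]

theorem residue_val (i : ℤ) : ((residue n i : ℕ) : ℤ) = i % n := by
  have hn : (0 : ℤ) < n := by exact_mod_cast Nat.pos_of_ne_zero (NeZero.ne n)
  simp only [residue]
  exact Int.toNat_of_nonneg (Int.emod_nonneg i hn.ne')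

theorem residue_add_mul (i t : ℤ) : residue n (i + n * t) = residue n i := by
  refine Fin.ext ?_
  have h1 := residue_val (n := n) (i + n * t)
  have h2 := residue_val (n := n) i
  rw [Int.add_mul_emod_self_left] at h1
  omega

theorem residue_coe (u : Fin n) : residue n (u : ℕ) = u := by
  refine Fin.ext ?_
  have h1 := residue_val (n := n) (u : ℕ)
  rw [Int.emod_eq_of_lt (by omega) (by exact_mod_cast u.2)] at h1
  omega

theorem intCoeff_add (p q : ℝ[X]) (d : ℤ) : intCoeff (p + q) d = intCoeff p d + intCoeff q d := by
  unfold intCoeff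
  split_ifs <;> simp

theorem intCoeff_C_mul (a : ℝ) (p : ℝ[X]) (d : ℤ) : intCoeff (C a * p) d = a * intCoeff p d := by
  unfold intCoeff
  split_ifs <;> simp

theorem intCoeff_X_mul (p : ℝ[X]) (d : ℤ) : intCoeff (X * p) d = intCoeff p (d - 1) := by
  unfold intCoeff
  rcases lt_trichotomy d 0 with h | rfl | h
  · rw [if_neg (by omega), if_neg (by omega)]
  · simp
  · rw [if_pos (by omega), if_pos (by omega)]
    obtain ⟨e, rfl⟩ : ∃ e : ℕ, d = e + 1 := ⟨(d - 1).toNat, by omega⟩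
    rw [show ((e : ℤ) + 1).toNat = e + 1 by omega, show ((e : ℤ) + 1 - 1).toNat = e by omega,
      coeff_X_mul]

theorem blockToeplitz_add_mul (P : Matrix (Fin n) (Fin n) ℝ[X]) (i j t : ℤ) :
    blockToeplitz P (i + n * t) (j + n * t) = blockToeplitz P i j := by
  have hn : (n : ℤ) ≠ 0 := by exact_mod_cast NeZero.ne n
  simp only [blockToeplitz, of_apply, residue_add_mul, Int.add_mul_ediv_left _ _ hn]
  congr 1
  ring

theorem blockToeplitz_coe (P : Matrix (Fin n) (Fin n) ℝ[X]) (u v : Fin n) (d : ℕ) :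
    blockToeplitz P (u : ℕ) ((v : ℕ) + n * (d : ℤ)) = (P u v).coeff d := by
  have hn : (n : ℤ) ≠ 0 := by exact_mod_cast NeZero.ne n
  have hu : ((u : ℕ) : ℤ) / n = 0 := Int.ediv_eq_zero_of_lt (by omega) (by exact_mod_cast u.2)
  have hv : ((v : ℕ) : ℤ) / n = 0 := Int.ediv_eq_zero_of_lt (by omega) (by exact_mod_cast v.2)
  simp [blockToeplitz, residue_add_mul, residue_coe, Int.add_mul_ediv_left _ _ hn, hu, hv,
    intCoeff]

theorem blockToeplitz_injective :
    Injective (blockToeplitz : Matrix (Fin n) (Fin n) ℝ[X] → Matrix ℤ ℤ ℝ) := by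
  intro P Q h
  ext u v d
  rw [← blockToeplitz_coe, h, blockToeplitz_coe]

theorem blockToeplitz_isPeriodicBand {P : Matrix (Fin n) (Fin n) ℝ[X]}
    (hP : IsUniUpperTriangular (evalAt P 0)) : IsPeriodicBand n (blockToeplitz P) := by
  have hn : (0 : ℤ) < n := by exact_mod_cast Nat.pos_of_ne_zero (NeZero.ne n)
  have hcoeff : ∀ u v, (P u v).coeff 0 = evalAt P 0 u v := by
    intro u v
    simp [evalAt, coeff_zero_eq_eval_zero]
  refine ⟨fun i j => ?_, fun i j hij => ?_, fun i => ?_, ?_⟩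
  · simpa using blockToeplitz_add_mul P i j 1
  · simp only [blockToeplitz, of_apply, intCoeff]
    split_ifs with h
    · have h0 : j / (n : ℤ) = i / (n : ℤ) :=
        le_antisymm (Int.ediv_le_ediv hn hij.le) (by omega)
      have hlt : residue n j < residue n i := by
        have h1 := residue_val (n := n) i
        have h2 := residue_val (n := n) j
        have h3 := Int.emod_add_mul_ediv i n
        have h4 := Int.emod_add_mul_ediv j n
        rw [h0] at h4
        rw [Fin.lt_def]
        omega
      rw [h0, sub_self, Int.toNat_zero, hcoeff]
      exact hP.1 _ _ hlt
    · rfl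
  · simp [blockToeplitz, intCoeff, hcoeff, hP.2]
  · obtain ⟨D, hD⟩ : ∃ D : ℕ, ∀ u v, (P u v).natDegree ≤ D :=
      ⟨Finset.univ.sup fun u => Finset.univ.sup fun v => (P u v).natDegree, fun u v =>
        (Finset.le_sup (f := fun v => (P u v).natDegree) (Finset.mem_univ v)).trans
          (Finset.le_sup (f := fun u => Finset.univ.sup fun v => (P u v).natDegree)
            (Finset.mem_univ u))⟩
    refine ⟨n * (D + 1), fun i j hij => ?_⟩
    have h1 : i / (n : ℤ) + (D + 1) ≤ j / (n : ℤ) := by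
      rw [← Int.add_mul_ediv_left _ _ hn.ne']
      exact Int.ediv_le_ediv hn hij.le
    simp only [blockToeplitz, of_apply, intCoeff]
    rw [if_pos (by omega)]
    refine coeff_eq_zero_of_natDegree_lt ?_
    have := hD (residue n i) (residue n j)
    omega

/-- In the last row of a block the factor `X` at the corner shifts the coefficient by one block,
which is exactly the passage from row `i` to row `i + 1` across the block boundary. -/
theorem blockToeplitz_whirl_mul (a : Fin n → ℝ) (P : Matrix (Fin n) (Fin n) ℝ[X]) (i j : ℤ) :
    blockToeplitz (whirl a * P) i j
      = blockToeplitz P i j + a (residue n i) * blockToeplitz P (i + 1) j := by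
  have hn : (0 : ℤ) < n := by exact_mod_cast Nat.pos_of_ne_zero (NeZero.ne n)
  have hi := residue_val (n := n) i
  have hi' := residue_val (n := n) (i + 1)
  have hdiv := Int.emod_add_mul_ediv i n
  have hlt := (residue n i).2
  have hentry : ∀ v, (whirl a * P) (residue n i) v = P (residue n i) v
      + ∑ l : Fin n, (if ((residue n i : Fin n) : ℕ) + 1 = (l : ℕ) then C (a (residue n i))
        else if ((residue n i : Fin n) : ℕ) + 1 = n ∧ (l : ℕ) = 0 then C (a (residue n i)) * X
        else 0) * P l v := by
    intro v
    rw [whirl, add_mul, one_mul]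
    simp only [Matrix.add_apply, Matrix.mul_apply, of_apply]
  simp only [blockToeplitz, of_apply]
  rw [hentry, intCoeff_add]
  congr 1
  by_cases h : ((residue n i : Fin n) : ℕ) + 1 < n
  · have hdiv' : (i + 1) / (n : ℤ) = i / n := by
      conv_lhs => rw [← hdiv, add_right_comm, Int.add_mul_ediv_left _ _ hn.ne']
      rw [Int.ediv_eq_zero_of_lt (by omega) (by omega), zero_add]
    have hmod : (i + 1) % (n : ℤ) = i % n + 1 := by
      have := Int.emod_add_mul_ediv (i + 1) n
      rw [hdiv'] at this
      omega
    have hres : ((residue n i : Fin n) : ℕ) + 1 = (residue n (i + 1) : Fin n) := by omega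
    rw [Finset.sum_eq_single (residue n (i + 1)), if_pos hres, intCoeff_C_mul, hdiv']
    · intro l _ hl
      rw [if_neg fun h' => hl (Fin.ext (by omega)), if_neg (by omega), zero_mul]
    · simp
  · have hmod : i % (n : ℤ) = n - 1 := by omega
    have hdiv' : (i + 1) / (n : ℤ) = i / n + 1 := by
      have : i + 1 = n * (i / n + 1) := by rw [mul_add, mul_one]; omega
      rw [this, Int.mul_ediv_cancel_left _ hn.ne']
    have hres : ((residue n (i + 1) : Fin n) : ℕ) = 0 := by
      have := Int.emod_add_mul_ediv (i + 1) n
      rw [hdiv', mul_add, mul_one] at this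
      omega
    rw [Finset.sum_eq_single (residue n (i + 1)), if_neg (by omega), if_pos (by omega), mul_assoc,
      intCoeff_C_mul, intCoeff_X_mul, hdiv', sub_sub]
    · intro l _ hl
      rw [if_neg (by omega), if_neg fun h' => hl (Fin.ext (by omega)), zero_mul]
    · simp

theorem blockToeplitz_one : blockToeplitz (1 : Matrix (Fin n) (Fin n) ℝ[X]) = 1 := by
  have hU : IsUniUpperTriangular (evalAt (1 : Matrix (Fin n) (Fin n) ℝ[X]) 0) := by
    have : evalAt (1 : Matrix (Fin n) (Fin n) ℝ[X]) 0 = 1 := by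
      ext u v
      by_cases h : u = v <;> simp [evalAt, h, one_apply]
    rw [this]
    exact ⟨fun i j h => one_apply_ne h.ne', fun i => one_apply_eq i⟩
  have hB := blockToeplitz_isPeriodicBand hU
  ext i j
  rcases lt_trichotomy j i with h | rfl | h
  · rw [hB.lower i j h, one_apply_ne h.ne']
  · rw [hB.diag, one_apply_eq]
  · rw [one_apply_ne h.ne]
    simp only [blockToeplitz, of_apply, intCoeff]
    split_ifs with hd
    · by_cases hres : residue n i = residue n j
      · rw [hres, one_apply_eq, coeff_one, if_neg]
        intro h0
        have h1 := residue_val (n := n) i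
        have h2 := residue_val (n := n) j
        have h3 := Int.emod_add_mul_ediv i n
        have h4 := Int.emod_add_mul_ediv j n
        rw [show j / (n : ℤ) = i / n by omega] at h4
        rw [hres] at h1
        omega
      · rw [one_apply_ne hres, coeff_zero]
    · rfl

theorem IsPeriodicBand.exists_blockToeplitz_eq {Y : Matrix ℤ ℤ ℝ} (hY : IsPeriodicBand n Y) :
    ∃ P : Matrix (Fin n) (Fin n) ℝ[X], blockToeplitz P = Y := by
  have hn : (0 : ℤ) < n := by exact_mod_cast Nat.pos_of_ne_zero (NeZero.ne n)
  obtain ⟨W, hW⟩ := hY.band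
  -- For `d ≥ W.toNat + 2`, column `v + n * d` exceeds `u + W` for every row `u < n`, so no nonzero
  -- entry is lost.
  set D : ℕ := W.toNat + 2 with hD
  set P : Matrix (Fin n) (Fin n) ℝ[X] := Matrix.of fun u v =>
    ∑ d ∈ Finset.range D, C (Y (u : ℕ) ((v : ℕ) + n * (d : ℤ))) * X ^ d with hP
  have hcoeff : ∀ u v d, (P u v).coeff d = Y (u : ℕ) ((v : ℕ) + n * (d : ℤ)) := by
    intro u v d
    simp only [hP, of_apply, finsetSum_coeff, coeff_C_mul, coeff_X_pow, mul_ite, mul_one, mul_zero,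
      Finset.sum_ite_eq, Finset.mem_range]
    split_ifs with h
    · rfl
    · refine (hW _ _ ?_).symm
      have h1 : W + 2 ≤ d := by omega
      have h2 : (2 : ℤ) ≤ d := by omega
      have h3 := u.2
      nlinarith
  refine ⟨P, ?_⟩
  ext i j
  simp only [blockToeplitz, of_apply, intCoeff, hcoeff, residue_val]
  have hi := Int.emod_add_mul_ediv i n
  have hj := Int.emod_add_mul_ediv j n
  split_ifs with h
  · rw [Int.toNat_of_nonneg h, ← hY.periodic_mul _ _ (i / n), hi]
    congr 1
    rw [add_assoc, ← mul_add, sub_add_cancel, hj]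
  · refine (hY.lower i j ?_).symm
    by_contra hij
    have := Int.ediv_le_ediv hn (not_lt.1 hij)
    omega

end Toeplitz

/-! ### Induction on the support, and both directions of the theorem -/

section Factorization

/-- The nonzero entries of a periodic matrix above the diagonal, in one period of rows. -/
def upperSupport (n : ℕ) (X : Matrix ℤ ℤ ℝ) : Set (ℤ × ℤ) :=
  {p | 0 ≤ p.1 ∧ p.1 < n ∧ p.1 < p.2 ∧ X p.1 p.2 ≠ 0}

theorem IsPeriodicBand.finite_upperSupport {n : ℕ} {X : Matrix ℤ ℤ ℝ} (hX : IsPeriodicBand n X) :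
    (upperSupport n X).Finite := by
  obtain ⟨W, hW⟩ := hX.band
  refine ((Set.finite_Icc (0 : ℤ) n).prod (Set.finite_Icc (0 : ℤ) (n + W))).subset ?_
  rintro ⟨i, j⟩ ⟨h0, h1, h2, h3⟩
  have : ¬ i + W < j := fun h => h3 (hW i j h)
  simp only [Set.mem_prod, Set.mem_Icc] at *
  omega

variable {n : ℕ} [NeZero n]

/-- In `X i j = Y i j + a i * Y (i + 1) j` nothing cancels, so the support of `Y` lies in that of
`X`. The dropped entry, moved into the base period, makes the inclusion strict. -/
theorem IsReduction.ncard_upperSupport_lt {X Y : Matrix ℤ ℤ ℝ} {a : ℤ → ℝ}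
    (h : IsReduction n X a Y) (hX : IsPeriodicBand n X) :
    (upperSupport n Y).ncard < (upperSupport n X).ncard := by
  have hn : (0 : ℤ) < n := by exact_mod_cast Nat.pos_of_ne_zero (NeZero.ne n)
  refine Set.ncard_lt_ncard ?_ hX.finite_upperSupport
  rw [Set.ssubset_iff_of_subset]
  · obtain ⟨i, j, hij, hXij, hYij⟩ := h.drop
    have hi := Int.emod_add_mul_ediv i n
    refine ⟨(i + n * -(i / n), j + n * -(i / n)), ⟨?_, ?_, ?_, ?_⟩, fun hY => hY.2.2.2 ?_⟩
    · have := Int.emod_nonneg i hn.ne'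
      simp only [mul_neg]
      omega
    · have := Int.emod_lt_of_pos i hn
      simp only [mul_neg]
      omega
    · simpa using hij
    · simpa only [hX.periodic_mul] using hXij
    · simpa only [h.isPeriodicBand.periodic_mul] using hYij
  · rintro ⟨i, j⟩ ⟨h0, h1, h2, h3⟩
    refine ⟨h0, h1, h2, ?_⟩
    have hpos : 0 < Y i j := lt_of_le_of_ne (h.totallyNonneg.entry_nonneg _ _) (Ne.symm h3)
    have := mul_nonneg (h.nonneg i) (h.totallyNonneg.entry_nonneg (i + 1) j)
    simp only [h.eq]
    positivity

theorem IsReduction.eq_whirl_mul {P Q : Matrix (Fin n) (Fin n) ℝ[X]} {a : ℤ → ℝ}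
    (h : IsReduction n (blockToeplitz P) a (blockToeplitz Q)) :
    P = whirl (fun u : Fin n => a (u : ℕ)) * Q := by
  refine blockToeplitz_injective ?_
  have ha : ∀ i t : ℤ, a (i + n * t) = a i := by
    intro i t
    induction t using Int.induction_on with
    | zero => simp
    | succ t ih =>
      rw [← ih, ← h.periodic (i + n * t)]
      congr 1; ring
    | pred t ih =>
      rw [← ih, ← h.periodic (i + n * (-t - 1))]
      congr 1; ring
  ext i j
  rw [blockToeplitz_whirl_mul, h.eq, residue_val, ← ha (i % n) (i / n), Int.emod_add_mul_ediv]

theorem exists_whirl_factorization (N : ℕ) : ∀ P : Matrix (Fin n) (Fin n) ℝ[X],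
    IsPeriodicBand n (blockToeplitz P) → TotallyNonneg (blockToeplitz P) →
    (upperSupport n (blockToeplitz P)).ncard = N →
    ∃ L : List (Fin n → ℝ), (∀ x ∈ L, ∀ i, 0 ≤ x i) ∧ P = (L.map whirl).prod := by
  induction N using Nat.strong_induction_on with
  | _ N ih =>
    intro P hP hT hN
    by_cases hne : ∃ i j, i < j ∧ blockToeplitz P i j ≠ 0
    · obtain ⟨a, Y, h⟩ := exists_reduction (Nat.pos_of_ne_zero (NeZero.ne n)) hP hT hne
      obtain ⟨Q, rfl⟩ := h.isPeriodicBand.exists_blockToeplitz_eq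
      obtain ⟨L, hL, hQ⟩ := ih _ (hN ▸ h.ncard_upperSupport_lt hP) Q h.isPeriodicBand
        h.totallyNonneg rfl
      refine ⟨(fun u : Fin n => a (u : ℕ)) :: L, ?_, ?_⟩
      · intro x hx
        rcases List.mem_cons.1 hx with rfl | hx
        · exact fun i => h.nonneg _
        · exact hL x hx
      · rw [List.map_cons, List.prod_cons, ← hQ]
        exact h.eq_whirl_mul
    · push Not at hne
      refine ⟨[], by simp, blockToeplitz_injective ?_⟩
      rw [List.map_nil, List.prod_nil, blockToeplitz_one]
      ext i j
      rcases lt_trichotomy j i with h | rfl | h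
      · rw [hP.lower i j h, one_apply_ne h.ne']
      · rw [hP.diag, one_apply_eq]
      · rw [hne i j h, one_apply_ne h.ne]

theorem totallyNonneg_whirl_prod (L : List (Fin n → ℝ)) (hL : ∀ x ∈ L, ∀ i, 0 ≤ x i) :
    TotallyNonneg (blockToeplitz (L.map whirl).prod) := by
  induction L with
  | nil =>
    rw [List.map_nil, List.prod_nil, blockToeplitz_one]
    exact totallyNonneg_one
  | cons x L ih =>
    have h := (ih fun y hy => hL y (List.mem_cons_of_mem _ hy)).add_next_row
      (a := fun i => x (residue n i)) fun i => hL x List.mem_cons_self _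
    refine (congrArg TotallyNonneg ?_).mpr h
    ext i j
    rw [List.map_cons, List.prod_cons, blockToeplitz_whirl_mul]
    rfl

end Factorization

end LoopTP

theorem mainTheorem9 (n : ℕ) [NeZero n] (P : Matrix (Fin n) (Fin n) (Polynomial ℝ))
    (hP : LoopTP.IsUniUpperTriangular (LoopTP.evalAt P 0)) :
    LoopTP.IsTotallyNonneg P ↔
      ∃ (m : ℕ) (x : Fin m → Fin n → ℝ),
        (∀ k i, 0 ≤ x k i) ∧ P = (List.ofFn fun k => LoopTP.whirl (x k)).prod := by
  constructor
  · intro h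
    obtain ⟨L, hL, hPL⟩ := LoopTP.exists_whirl_factorization _ P
      (LoopTP.blockToeplitz_isPeriodicBand hP) h rfl
    refine ⟨L.length, L.get, fun k => hL _ (List.get_mem L k), ?_⟩
    rw [hPL]
    congr 1
    exact (List.ofFn_getElem_eq_map L LoopTP.whirl).symm
  · rintro ⟨m, x, hx, rfl⟩
    have := LoopTP.totallyNonneg_whirl_prod (List.ofFn x) (by
      intro y hy
      obtain ⟨k, rfl⟩ := List.mem_ofFn.1 hy
      exact hx k)
    rw [List.map_ofFn] at this
    exact this
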